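/- Let $\ln$ be the natural logarithm. For $b_1\ge\dots\ge b_d>0$ let $E_b=\{x\in\mathbb{R}^d:\sum_{i=1}^d x_i^2/b_i^2\le 1\}$ be the ellipsoid with semi-axes $b_1,\dots,b_d$, and let $\mathcal{H}_1(E_b)$, its unit entropy, be the natural logarithm of the minimal number of closed Euclidean balls of radius $1$, with centres in $\mathbb{R}^d$, that cover $E_b$. Put $K_b=\sum_{i:\,b_i>1}\ln b_i$ and $m_b=\#\{i: b_i>1\}$. There is a universal constant $c>0$ such that, for every $d\ge 2$ and all $b_1\ge\dots\ge b_d>0$, $$\mathcal{H}_1(E_b)\le K_b+c\left[\ln d+\sqrt{\ln(b_1)\,m_b\,\ln d}\right].$$ (If $b_1\le 1$ then $m_b=0$ and the square root is $0$.) -/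

import Mathlib

open scoped ENNReal NNReal

/-- The ellipsoid `E_b ⊂ ℝ^d` with semi-axes `b 0, …, b (d - 1)`, in Euclidean space. -/
def ellipsoid {d : ℕ} (b : Fin d → ℝ) : Set (EuclideanSpace ℝ (Fin d)) :=
  {x | ∑ i, x i ^ 2 / b i ^ 2 ≤ 1}

/-- The `ε`-entropy of a set `S ⊆ ℝ^d`: the natural logarithm of the least number of closed
Euclidean balls of radius `ε`, with centres anywhere in `ℝ^d`, that cover `S`.
It is `EReal`-valued, and equal to `⊤` exactly when no finite covering exists. -/
noncomputable def metricEntropy {d : ℕ} (ε : ℝ≥0) (S : Set (EuclideanSpace ℝ (Fin d))) : EReal :=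
  ENNReal.log ((Metric.externalCoveringNumber ε S : ℕ∞) : ℝ≥0∞)

/-- `m_b`, the number of semi-axes that are larger than `1`. -/
noncomputable def numLargeAxes {d : ℕ} (b : Fin d → ℝ) : ℕ :=
  (Finset.univ.filter fun i => 1 < b i).card

/-- `K_b`, the sum of `ln b_i` over the semi-axes `b_i` that are larger than `1`. -/
noncomputable def logVolumeLargeAxes {d : ℕ} (b : Fin d → ℝ) : ℝ :=
  ∑ i ∈ Finset.univ.filter fun i => 1 < b i, Real.log (b i)

/-!
Round the logarithms of the semi-axes larger than `1` up to multiples of `δ`, and the other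
semi-axes up to `1`. This costs at most `m_b δ` in log-volume, and the ellipsoid becomes a block
ellipsoid with about `ln b_1 / δ` blocks, each a multiple of a Euclidean ball. Distributing the
energy `∑ x_i² / b_i² ≤ 1` over the blocks along a grid covers the block ellipsoid by few products
of balls. A ball of radius `r R` in dimension `n` is covered by `60 n³ rⁿ` balls of radius `R`, so
each block loses only a factor polynomial in `d`. Hence the entropy is at most
`K_b + m_b δ + O((1 + ln b_1 / δ) ln d)`, and it remains to optimise `δ`.

The ball covering is greedy: if `1 < r`, there is a radius `ρ` such that every unit ball centred in
the ball of radius `r` occupies a fraction `≥ c / (n rⁿ)` of the ball of radius `ρ`. By averaging,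
some point of the latter ball lies within distance `1` of that fraction of any given finite set, and
`O(n² rⁿ ln n)` such points cover all but a few points of a fine net.
-/

open MeasureTheory Metric Module
open scoped Finset

section Packing

variable {E : Type*} [NormedAddCommGroup E] [NormedSpace ℝ E] [FiniteDimensional ℝ E]

theorem card_le_of_isSeparated_of_subset_closedBall {s : Finset E} {x : E} {r η : ℝ≥0}
    (hη : 0 < η) (hs : IsSeparated η (s : Set E)) (hsr : (s : Set E) ⊆ closedBall x r) :
    (#s : ℝ) ≤ (1 + 2 * r / η) ^ finrank ℝ E := by
  borelize E
  let μ : Measure E := Measure.addHaar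
  have hdisj : (s : Set E).PairwiseDisjoint fun c => closedBall c (η / 2 : ℝ) := by
    intro c hc e he hce
    refine closedBall_disjoint_closedBall ?_
    have hlt : (η : ℝ≥0∞) < edist c e := hs hc he hce
    rw [edist_nndist, ENNReal.coe_lt_coe] at hlt
    rw [add_halves]
    exact_mod_cast hlt
  have hsub : ⋃ c ∈ s, closedBall c (η / 2 : ℝ) ⊆ closedBall x (r + η / 2) :=
    Set.iUnion₂_subset fun c hc => closedBall_subset_closedBall' <| by
      linarith [mem_closedBall.1 (hsr hc)]
  have hvol : (#s * (η / 2 : ℝ) ^ finrank ℝ E) * μ.real (closedBall 0 1) ≤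
      (r + η / 2 : ℝ) ^ finrank ℝ E * μ.real (closedBall 0 1) :=
    calc
      _ = ∑ c ∈ s, μ.real (closedBall c (η / 2)) := by
        simp only [μ.addHaar_real_closedBall' _ (by positivity : (0 : ℝ) ≤ η / 2),
          Finset.sum_const, nsmul_eq_mul, mul_assoc]
      _ = μ.real (⋃ c ∈ s, closedBall c (η / 2 : ℝ)) :=
        (measureReal_biUnion_finset hdisj (fun _ _ => measurableSet_closedBall)
          fun _ _ => measure_closedBall_lt_top.ne).symm
      _ ≤ μ.real (closedBall x (r + η / 2)) := measureReal_mono hsub measure_closedBall_lt_top.ne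
      _ = _ := μ.addHaar_real_closedBall' x (by positivity)
  have hpos : 0 < μ.real (closedBall (0 : E) 1) :=
    ENNReal.toReal_pos (measure_closedBall_pos _ _ one_pos).ne' measure_closedBall_lt_top.ne
  have hratio : (1 + 2 * r / η : ℝ) = (r + η / 2) / (η / 2) := by field_simp; ring
  rw [hratio, div_pow, le_div_iff₀ (by positivity)]
  exact le_of_mul_le_mul_right hvol hpos

theorem packingNumber_closedBall_le (x : E) (r : ℝ≥0) {η : ℝ≥0} (hη : 0 < η) :
    packingNumber η (closedBall x r) ≤ ⌊(1 + 2 * r / η : ℝ) ^ finrank ℝ E⌋₊ := by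
  refine iSup_le fun s => iSup₂_le fun hsr hs => ?_
  by_contra! hlt
  obtain ⟨t, hts, ht⟩ := Set.exists_subset_encard_eq (Order.add_one_le_of_lt hlt)
  have htfin : t.Finite := Set.finite_of_encard_eq_coe ht
  lift t to Finset E using htfin
  rw [Set.encard_coe_eq_coe_finsetCard] at ht
  have hcard := Nat.le_floor
    (card_le_of_isSeparated_of_subset_closedBall hη (hs.subset hts) (hts.trans hsr))
  norm_cast at ht hcard
  omega

theorem exists_finset_net_closedBall (x : E) {r η : ℝ} (hr : 0 ≤ r) (hη : 0 < η) :
    ∃ s : Finset E, (s : Set E) ⊆ closedBall x r ∧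
      closedBall x r ⊆ ⋃ y ∈ s, closedBall y η ∧ (#s : ℝ) ≤ (1 + 2 * r / η) ^ finrank ℝ E := by
  lift r to ℝ≥0 using hr
  lift η to ℝ≥0 using hη.le
  have hle := (coveringNumber_le_packingNumber η (closedBall x r)).trans
    (packingNumber_closedBall_le x r (by exact_mod_cast hη))
  have hfin : coveringNumber η (closedBall x r) ≠ ⊤ := ne_top_of_le_ne_top (by simp) hle
  obtain ⟨s, hs⟩ := (finite_minimalCover (ε := η) (A := closedBall x r)).exists_finset_coe
  refine ⟨s, hs ▸ minimalCover_subset, ?_, ?_⟩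
  · simpa only [← hs, Finset.mem_coe] using
      isCover_iff_subset_iUnion_closedBall.1 (isCover_minimalCover hfin)
  · rw [← encard_minimalCover hfin, ← hs, Set.encard_coe_eq_coe_finsetCard, Nat.cast_le] at hle
    exact (Nat.le_floor_iff (by positivity)).1 hle

end Packing

section Slab

variable {E : Type*} [NormedAddCommGroup E] [InnerProductSpace ℝ E] [FiniteDimensional ℝ E]

theorem exists_contraction_inner_eq_mul (x : E) {t : ℝ} (ht₀ : 0 ≤ t) (ht₁ : t ≤ 1) :
    ∃ T : E →ₗ[ℝ] E, t ≤ LinearMap.det T ∧ (∀ w, ‖T w‖ ≤ ‖w‖) ∧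
      ∀ w, inner ℝ x (T w) = t * inner ℝ x w := by
  rcases eq_or_ne x 0 with rfl | hx
  · exact ⟨LinearMap.id, by simpa using ht₁, by simp, by simp⟩
  set c : ℝ := (1 - t) / ‖x‖ ^ 2 with hc
  have hc₀ : 0 ≤ c := div_nonneg (by linarith) (by positivity)
  have hcx : c * ‖x‖ ^ 2 = 1 - t := by rw [hc]; field_simp
  refine ⟨LinearMap.transvection (innerₛₗ ℝ x) (-(c • x)), ?_, fun w => ?_, fun w => ?_⟩
  · simp only [LinearMap.transvection.det, innerₛₗ_apply_apply, inner_neg_right, inner_smul_right,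
      real_inner_self_eq_norm_sq]
    linarith
  · have hsq : ‖w + inner ℝ x w • -(c • x)‖ ^ 2 =
        ‖w‖ ^ 2 - c * (1 + t) * inner ℝ x w ^ 2 := by
      simp only [norm_add_sq_real, inner_smul_right, inner_neg_right, norm_smul, norm_neg, mul_pow,
        Real.norm_eq_abs, sq_abs, real_inner_comm x w]
      linear_combination inner ℝ x w ^ 2 * c * hcx
    rw [LinearMap.transvection.apply, innerₛₗ_apply_apply,
      ← sq_le_sq₀ (norm_nonneg _) (norm_nonneg _), hsq]
    exact sub_le_self _ (mul_nonneg (mul_nonneg hc₀ (by linarith)) (sq_nonneg _))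
  · simp only [LinearMap.transvection.apply, innerₛₗ_apply_apply, inner_add_right,
      inner_smul_right, inner_neg_right, real_inner_self_eq_norm_sq, hcx]
    ring

variable [MeasurableSpace E] [BorelSpace E] (μ : Measure E) [μ.IsAddHaarMeasure]

theorem measureReal_closedBall_le_two_mul_half (x : E) (q : ℝ) :
    μ.real (closedBall 0 q) ≤ 2 * μ.real {v ∈ closedBall 0 q | 0 ≤ inner ℝ x v} := by
  set H : Set E := {v ∈ closedBall 0 q | 0 ≤ inner ℝ x v}
  have hcover : closedBall (0 : E) q ⊆ H ∪ -H := by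
    intro v hv
    rcases le_total 0 (inner ℝ x v) with h | h
    · exact Or.inl ⟨hv, h⟩
    · exact Or.inr ⟨by simpa using hv, by simpa [inner_neg_right] using h⟩
  have hH : μ H ≠ ∞ := measure_ne_top_of_subset (Set.sep_subset _ _) measure_closedBall_lt_top.ne
  calc
    μ.real (closedBall 0 q) ≤ μ.real (H ∪ -H) :=
      measureReal_mono hcover (measure_union_ne_top hH (by rwa [Measure.measure_neg]))
    _ ≤ μ.real H + μ.real (-H) := measureReal_union_le _ _
    _ = 2 * μ.real H := by
      rw [measureReal_def μ (-H), Measure.measure_neg, two_mul, measureReal_def]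

theorem mul_measureReal_closedBall_le_two_mul_slab (x : E) (q : ℝ) {t : ℝ} (ht₀ : 0 ≤ t)
    (ht₁ : t ≤ 1) :
    t * μ.real (closedBall 0 q) ≤
      2 * μ.real {v ∈ closedBall 0 q | inner ℝ x v ∈ Set.Icc 0 (t * (‖x‖ * q))} := by
  obtain ⟨T, hdet, hT, hTx⟩ := exists_contraction_inner_eq_mul x ht₀ ht₁
  set H : Set E := {v ∈ closedBall 0 q | 0 ≤ inner ℝ x v}
  have himage : T '' H ⊆ {v ∈ closedBall 0 q | inner ℝ x v ∈ Set.Icc 0 (t * (‖x‖ * q))} := by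
    rintro _ ⟨w, ⟨hw, hw₀⟩, rfl⟩
    rw [mem_closedBall_zero_iff] at hw
    have hxw : inner ℝ x w ≤ ‖x‖ * q := (real_inner_le_norm x w).trans (by gcongr)
    refine ⟨mem_closedBall_zero_iff.2 ((hT w).trans hw), ?_⟩
    rw [hTx]
    exact ⟨by positivity, by gcongr⟩
  calc
    t * μ.real (closedBall 0 q) ≤ t * (2 * μ.real H) := by
      gcongr
      exact measureReal_closedBall_le_two_mul_half μ x q
    _ ≤ 2 * (LinearMap.det T * μ.real H) := by
      rw [mul_left_comm]
      gcongr
    _ = 2 * μ.real (T '' H) := by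
      rw [measureReal_def μ (T '' H), Measure.addHaar_image_linearMap, ENNReal.toReal_mul,
        abs_of_nonneg (ht₀.trans hdet), ENNReal.toReal_ofReal (ht₀.trans hdet), measureReal_def]
    _ ≤ _ := by
      gcongr
      exact measure_ne_top_of_subset (Set.sep_subset _ _) measure_closedBall_lt_top.ne

end Slab

section BallIntersection

variable {E : Type*} [NormedAddCommGroup E] [InnerProductSpace ℝ E]

theorem smul_add_mem_closedBall_one {x v : E} {r q : ℝ} (hr : r ≠ 0) (hq : q ^ 2 = 1 - 1 / r ^ 2)
    (hx : ‖x‖ ≤ r) (hv : ‖v‖ ≤ q) (hxv : 0 ≤ inner ℝ x v) : q ^ 2 • x + v ∈ closedBall x 1 := by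
  have hsub : x - (q ^ 2 • x + v) = (1 / r ^ 2) • x - v := by rw [hq]; module
  have hx₂ : (1 / r ^ 2) ^ 2 * ‖x‖ ^ 2 ≤ 1 / r ^ 2 :=
    calc
      (1 / r ^ 2) ^ 2 * ‖x‖ ^ 2 ≤ (1 / r ^ 2) ^ 2 * r ^ 2 := by gcongr
      _ = 1 / r ^ 2 := by field_simp
  have hv₂ : ‖v‖ ^ 2 ≤ q ^ 2 := by gcongr
  rw [mem_closedBall', dist_eq_norm, hsub, ← sq_le_sq₀ (norm_nonneg _) zero_le_one,
    norm_sub_sq_real, norm_smul, mul_pow, Real.norm_eq_abs, sq_abs, real_inner_smul_left]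
  linarith [show 0 ≤ 1 / r ^ 2 * inner ℝ x v by positivity]

theorem smul_add_mem_closedBall_zero {x v : E} {r q t : ℝ} (hr : 1 ≤ r) (ht : 0 ≤ t)
    (hq : q ^ 2 = 1 - 1 / r ^ 2) (hx : ‖x‖ ≤ r) (hv : ‖v‖ ≤ q)
    (hxv : inner ℝ x v ≤ t * (‖x‖ * q)) : q ^ 2 • x + v ∈ closedBall 0 (q * r * (1 + t)) := by
  have hq₀ : 0 ≤ q := (norm_nonneg v).trans hv
  have hqr : (q * r) ^ 2 = r ^ 2 - 1 := by rw [mul_pow, hq]; field_simp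
  have hq₁ : q ≤ 1 := by nlinarith [show 0 ≤ 1 / r ^ 2 by positivity]
  have hx₂ : (q ^ 2) ^ 2 * ‖x‖ ^ 2 + q ^ 2 ≤ (q * r) ^ 2 :=
    calc
      (q ^ 2) ^ 2 * ‖x‖ ^ 2 + q ^ 2 ≤ (q ^ 2) ^ 2 * r ^ 2 + q ^ 2 := by gcongr
      _ = (q * r) ^ 2 := by linear_combination q ^ 2 * hqr
  have hxv₂ : q ^ 2 * inner ℝ x v ≤ t * (q * r) ^ 2 :=
    calc
      q ^ 2 * inner ℝ x v ≤ q ^ 2 * (t * (r * r)) := by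
        gcongr
        refine hxv.trans ?_
        gcongr
        exact hq₁.trans hr
      _ = t * (q * r) ^ 2 := by ring
  have hv₂ : ‖v‖ ^ 2 ≤ q ^ 2 := by gcongr
  rw [mem_closedBall_zero_iff, ← sq_le_sq₀ (norm_nonneg _) (by positivity), norm_add_sq_real,
    norm_smul, mul_pow, Real.norm_eq_abs, sq_abs, real_inner_smul_left]
  nlinarith [show 0 ≤ (t * (q * r)) ^ 2 by positivity]

variable [FiniteDimensional ℝ E] [MeasurableSpace E] [BorelSpace E]

-- The centre `(1 - 1 / r ^ 2) • x` and the radius `q` are those of the smallest ball containing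
-- `closedBall x 1 ∩ closedBall 0 √(r ^ 2 - 1)` when `‖x‖ = r`. Half of that ball lies in
-- `closedBall x 1`, and flattening this half by the factor `n` keeps it close to the origin.
theorem exists_radius_measureReal_closedBall_le_inter [Nontrivial E] (μ : Measure E)
    [μ.IsAddHaarMeasure] {r : ℝ} (hr : 1 < r) :
    ∃ R : ℝ, 0 < R ∧ ∀ x : E, ‖x‖ ≤ r →
      μ.real (closedBall (0 : E) R) ≤ 2 * Real.exp 1 * finrank ℝ E * r ^ finrank ℝ E *
        μ.real (closedBall x 1 ∩ closedBall 0 R) := by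
  set n := finrank ℝ E
  have hn : (1 : ℝ) ≤ n := by exact_mod_cast (finrank_pos : 0 < finrank ℝ E)
  have hq_arg : 0 < 1 - 1 / r ^ 2 := by
    rw [sub_pos, div_lt_one (by positivity)]
    exact one_lt_pow₀ hr two_ne_zero
  set q := √(1 - 1 / r ^ 2)
  have hq₀ : 0 < q := Real.sqrt_pos.2 hq_arg
  have hq : q ^ 2 = 1 - 1 / r ^ 2 := Real.sq_sqrt hq_arg.le
  set R := q * r * (1 + 1 / n)
  refine ⟨R, by positivity, fun x hx => ?_⟩
  set S : Set E := {v ∈ closedBall 0 q | inner ℝ x v ∈ Set.Icc 0 (1 / n * (‖x‖ * q))}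
  have hslab : μ.real (closedBall 0 q) ≤ n * (2 * μ.real S) := by
    have := mul_measureReal_closedBall_le_two_mul_slab μ x q (t := 1 / n) (by positivity)
      (div_le_one_of_le₀ hn (by positivity))
    rwa [one_div_mul_eq_div, div_le_iff₀' (by positivity)] at this
  have hS : (q ^ 2 • x + ·) '' S ⊆ closedBall x 1 ∩ closedBall 0 R := by
    rintro _ ⟨v, ⟨hv, hxv₀, hxv⟩, rfl⟩
    rw [mem_closedBall_zero_iff] at hv
    exact ⟨smul_add_mem_closedBall_one (by positivity) hq hx hv hxv₀,
      smul_add_mem_closedBall_zero hr.le (by positivity) hq hx hv hxv⟩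
  have hSμ : μ.real S ≤ μ.real (closedBall x 1 ∩ closedBall 0 R) :=
    calc
      μ.real S = μ.real ((q ^ 2 • x + ·) '' S) := by
        simp only [measureReal_def, Set.image_add_left, measure_preimage_add]
      _ ≤ _ := measureReal_mono hS
        (measure_ne_top_of_subset Set.inter_subset_left measure_closedBall_lt_top.ne)
  calc
    μ.real (closedBall 0 R) = (1 + 1 / n : ℝ) ^ n * r ^ n * μ.real (closedBall 0 q) := by
      rw [μ.addHaar_real_closedBall' 0 (by positivity : 0 ≤ R),
        μ.addHaar_real_closedBall' 0 hq₀.le, mul_pow, mul_pow]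
      ring
    _ ≤ Real.exp 1 * r ^ n * (n * (2 * μ.real (closedBall x 1 ∩ closedBall 0 R))) := by
      gcongr
      · exact one_div (n : ℝ) ▸ Real.one_add_inv_pow_le_exp
      · exact hslab.trans (by gcongr)
    _ = _ := by ring

end BallIntersection

section Greedy

open scoped Classical in
theorem exists_mem_card_le_mul_card_filter_mem {α ι : Type*} [MeasurableSpace α] {μ : Measure α}
    {A : Set α} (hA₀ : μ A ≠ 0) (hA : μ A ≠ ∞) {Y : Finset ι} {B : ι → Set α}
    (hB : ∀ y ∈ Y, MeasurableSet (B y)) {K : ℝ}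
    (h : ∀ y ∈ Y, μ.real A ≤ K * μ.real (B y ∩ A)) :
    ∃ c ∈ A, (#Y : ℝ) ≤ K * #{y ∈ Y | c ∈ B y} := by
  have hμA : 0 < μ.real A := ENNReal.toReal_pos hA₀ hA
  have hint : ∀ y ∈ Y, IntegrableOn ((B y).indicator fun _ => K) A μ := fun y hy =>
    (integrableOn_const (C := K) hA).indicator (hB y hy)
  obtain ⟨c, hcA, hc⟩ := exists_setAverage_le hA₀ hA (integrable_finsetSum Y hint :
    IntegrableOn (fun c => ∑ y ∈ Y, (B y).indicator (fun _ => K) c) A μ)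
  refine ⟨c, hcA, ?_⟩
  calc
    (#Y : ℝ) ≤ ⨍ a in A, ∑ y ∈ Y, (B y).indicator (fun _ => K) a ∂μ := by
      rw [setAverage_eq, smul_eq_mul, le_inv_mul_iff₀ hμA, integral_finsetSum Y hint, mul_comm,
        ← nsmul_eq_mul]
      refine Finset.card_nsmul_le_sum Y _ _ fun y hy => ?_
      rw [integral_indicator_const _ (hB y hy), smul_eq_mul,
        measureReal_restrict_apply (hB y hy), mul_comm]
      exact h y hy
    _ ≤ ∑ y ∈ Y, (B y).indicator (fun _ => K) c := hc
    _ = K * #{y ∈ Y | c ∈ B y} := by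
      simp only [Set.indicator_apply, ← Finset.sum_filter, Finset.sum_const, nsmul_eq_mul,
        mul_comm]

variable {α β : Type*} {X : Finset α} {R : β → α → Prop} [∀ c, DecidablePred (R c)] {K : ℝ}

theorem exists_card_le_card_filter_forall_not_le_pow (hK : 1 ≤ K)
    (h : ∀ Y ⊆ X, ∃ c, (#Y : ℝ) ≤ K * #{y ∈ Y | R c y}) (k : ℕ) :
    ∃ C : Finset β, #C ≤ k ∧ (#{y ∈ X | ∀ c ∈ C, ¬ R c y} : ℝ) ≤ (1 - 1 / K) ^ k * #X := by
  classical
  induction k with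
  | zero => exact ⟨∅, by simp⟩
  | succ k ih =>
    obtain ⟨C, hCk, hC⟩ := ih
    set Y : Finset α := {y ∈ X | ∀ c ∈ C, ¬ R c y}
    obtain ⟨c, hc⟩ := h Y (X.filter_subset _)
    refine ⟨insert c C, (Finset.card_insert_le c C).trans (by lia), ?_⟩
    have hinsert : {y ∈ X | ∀ e ∈ insert c C, ¬ R e y} = {y ∈ Y | ¬ R c y} := by
      ext y
      simp only [Y, Finset.mem_filter, Finset.forall_mem_insert]
      tauto
    have hsplit : (#{y ∈ Y | R c y} : ℝ) + #{y ∈ Y | ¬ R c y} = #Y := by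
      exact_mod_cast Finset.card_filter_add_card_filter_not (s := Y) (R c)
    have hhit : 1 / K * #Y ≤ #{y ∈ Y | R c y} := by
      rwa [one_div_mul_eq_div, div_le_iff₀' (by positivity)]
    have hK₁ : 0 ≤ 1 - 1 / K := sub_nonneg.2 (div_le_one_of_le₀ hK (by positivity))
    calc
      (#{y ∈ X | ∀ e ∈ insert c C, ¬ R e y} : ℝ) ≤ (1 - 1 / K) * #Y := by rw [hinsert]; linarith
      _ ≤ (1 - 1 / K) * ((1 - 1 / K) ^ k * #X) := by gcongr
      _ = (1 - 1 / K) ^ (k + 1) * #X := by ring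

theorem exists_card_le_log_card_filter_forall_not_le_div (hK : 1 ≤ K)
    (h : ∀ Y ⊆ X, ∃ c, (#Y : ℝ) ≤ K * #{y ∈ Y | R c y}) {M : ℝ} (hM : 1 ≤ M) :
    ∃ C : Finset β, (#C : ℝ) ≤ K * Real.log M + 1 ∧
      (#{y ∈ X | ∀ c ∈ C, ¬ R c y} : ℝ) ≤ #X / M := by
  obtain ⟨C, hCk, hC⟩ := exists_card_le_card_filter_forall_not_le_pow hK h ⌈K * Real.log M⌉₊
  have hlog : 0 ≤ Real.log M := Real.log_nonneg hM
  refine ⟨C, (Nat.cast_le.2 hCk).trans (Nat.ceil_lt_add_one (by positivity)).le, hC.trans ?_⟩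
  rw [div_eq_inv_mul (#X : ℝ)]
  gcongr
  calc
    (1 - 1 / K) ^ ⌈K * Real.log M⌉₊ ≤ Real.exp (-(1 / K)) ^ ⌈K * Real.log M⌉₊ := by
      gcongr
      · exact sub_nonneg.2 (div_le_one_of_le₀ hK (by positivity))
      · exact Real.one_sub_le_exp_neg _
    _ = Real.exp (-(⌈K * Real.log M⌉₊ / K)) := by rw [← Real.exp_nat_mul]; ring_nf
    _ ≤ Real.exp (-Real.log M) := by
      gcongr
      rw [le_div_iff₀' (by positivity)]
      exact Nat.le_ceil _
    _ = M⁻¹ := by rw [Real.exp_neg, Real.exp_log (by positivity)]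

end Greedy

section BallCovering

variable {E : Type*} [NormedAddCommGroup E] [InnerProductSpace ℝ E] [FiniteDimensional ℝ E]
  [Nontrivial E]

open scoped Classical in
theorem exists_card_le_mul_card_filter_mem_closedBall {r : ℝ} (hr : 1 < r) {Y : Finset E}
    (hY : (Y : Set E) ⊆ closedBall 0 r) :
    ∃ c : E, (#Y : ℝ) ≤
      2 * Real.exp 1 * finrank ℝ E * r ^ finrank ℝ E * #{y ∈ Y | c ∈ closedBall y 1} := by
  borelize E
  let μ : Measure E := Measure.addHaar
  obtain ⟨R, hR, h⟩ := exists_radius_measureReal_closedBall_le_inter μ hr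
  obtain ⟨c, -, hc⟩ := exists_mem_card_le_mul_card_filter_mem (measure_closedBall_pos μ 0 hR).ne'
    measure_closedBall_lt_top.ne (fun _ _ => measurableSet_closedBall)
    fun y hy => h y (mem_closedBall_zero_iff.1 (hY hy))
  exact ⟨c, hc⟩

theorem exists_cover_of_subset_closedBall {r : ℝ} (hr : 1 < r) {X : Finset E}
    (hX : (X : Set E) ⊆ closedBall 0 r) {M : ℝ} (hM : 1 ≤ M) :
    ∃ C : Finset E, (X : Set E) ⊆ ⋃ c ∈ C, closedBall c 1 ∧
      (#C : ℝ) ≤ 2 * Real.exp 1 * finrank ℝ E * r ^ finrank ℝ E * Real.log M + 1 + #X / M := by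
  classical
  have hn : (1 : ℝ) ≤ finrank ℝ E := by exact_mod_cast (finrank_pos : 0 < finrank ℝ E)
  have hK : 1 ≤ 2 * Real.exp 1 * finrank ℝ E * r ^ finrank ℝ E :=
    one_le_mul_of_one_le_of_one_le (one_le_mul_of_one_le_of_one_le
      (by linarith [Real.one_le_exp zero_le_one]) hn) (one_le_pow₀ hr.le)
  obtain ⟨C, hC, hmissed⟩ := exists_card_le_log_card_filter_forall_not_le_div (X := X)
    (R := fun c y => c ∈ closedBall y 1) hK (fun Y hY =>
      exists_card_le_mul_card_filter_mem_closedBall hr ((Finset.coe_subset.2 hY).trans hX)) hM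
  set Z : Finset E := {y ∈ X | ∀ c ∈ C, c ∉ closedBall y 1}
  refine ⟨C ∪ Z, fun y hy => ?_, ?_⟩
  · rw [Set.mem_iUnion₂]
    by_cases hcov : ∀ c ∈ C, c ∉ closedBall y 1
    · exact ⟨y, Finset.mem_union_right _ (Finset.mem_filter.2 ⟨hy, hcov⟩),
        mem_closedBall_self zero_le_one⟩
    · push Not at hcov
      obtain ⟨c, hc, hcy⟩ := hcov
      exact ⟨c, Finset.mem_union_left _ hc, mem_closedBall_comm.1 hcy⟩
  · calc
      (#(C ∪ Z) : ℝ) ≤ #C + #Z := by exact_mod_cast Finset.card_union_le C Z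
      _ ≤ _ := add_le_add hC hmissed

theorem exists_cover_closedBall_one_add {r : ℝ} (hr : 1 < r) :
    ∃ C : Finset E, closedBall (0 : E) r ⊆ ⋃ c ∈ C, closedBall c (1 + 1 / finrank ℝ E) ∧
      (#C : ℝ) ≤ 20 * finrank ℝ E ^ 3 * r ^ finrank ℝ E := by
  set n := finrank ℝ E
  have hn : (1 : ℝ) ≤ n := by exact_mod_cast (finrank_pos : 0 < finrank ℝ E)
  obtain ⟨X, hXr, hXnet, hX⟩ := exists_finset_net_closedBall (0 : E) (by linarith : 0 ≤ r)
    (by positivity : 0 < 1 / (n : ℝ))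
  obtain ⟨C, hXC, hC⟩ := exists_cover_of_subset_closedBall hr hXr
    (one_le_pow₀ (by linarith) : 1 ≤ (3 * n : ℝ) ^ n)
  refine ⟨C, fun x hx => ?_, hC.trans ?_⟩
  · obtain ⟨y, hy, hxy⟩ := Set.mem_iUnion₂.1 (hXnet hx)
    obtain ⟨c, hc, hyc⟩ := Set.mem_iUnion₂.1 (hXC hy)
    exact Set.mem_iUnion₂.2 ⟨c, hc, mem_closedBall.2 <| (dist_triangle x y c).trans <| by
      linarith [mem_closedBall.1 hxy, mem_closedBall.1 hyc]⟩
  · have hnet : #X / (3 * n : ℝ) ^ n ≤ r ^ n := by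
      rw [div_le_iff₀ (by positivity), ← mul_pow]
      refine hX.trans ?_
      gcongr
      rw [div_div_eq_mul_div, div_one]
      nlinarith
    have hlog : Real.log ((3 * n : ℝ) ^ n) ≤ 3 * n ^ 2 := by
      rw [Real.log_pow]
      nlinarith [Real.log_le_self (by positivity : 0 ≤ 3 * (n : ℝ))]
    have hrn : 1 ≤ r ^ n := one_le_pow₀ hr.le
    have hrn₃ : r ^ n ≤ n ^ 3 * r ^ n := le_mul_of_one_le_left (by positivity) (one_le_pow₀ hn)
    calc
      2 * Real.exp 1 * n * r ^ n * Real.log ((3 * n : ℝ) ^ n) + 1 + #X / (3 * n : ℝ) ^ n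
          ≤ 2 * 3 * n * r ^ n * (3 * n ^ 2) + r ^ n + r ^ n := by
        gcongr
        · exact Real.log_nonneg (one_le_pow₀ (by linarith))
        · exact Real.exp_one_lt_three.le
      _ ≤ 20 * n ^ 3 * r ^ n := by linarith

theorem exists_cover_closedBall_mul {r R : ℝ} (hr : 1 < r) (hR : 0 < R) :
    ∃ C : Finset E, closedBall (0 : E) (r * R) ⊆ ⋃ c ∈ C, closedBall c R ∧
      (#C : ℝ) ≤ 60 * finrank ℝ E ^ 3 * r ^ finrank ℝ E := by
  classical
  set n := finrank ℝ E
  have hn : (0 : ℝ) < 1 / n := by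
    have : (0 : ℝ) < n := by exact_mod_cast (finrank_pos : 0 < finrank ℝ E)
    positivity
  set a : ℝ := 1 + 1 / n
  have ha₀ : 0 < a := by positivity
  obtain ⟨C, hcov, hC⟩ := exists_cover_closedBall_one_add (E := E) (r := r * a) (by nlinarith)
  refine ⟨C.image ((R / a) • ·), fun x hx => ?_, ?_⟩
  · have hscaled : (a / R) • x ∈ closedBall 0 (r * a) := by
      rw [mem_closedBall_zero_iff] at hx ⊢
      rw [norm_smul, Real.norm_of_nonneg (by positivity)]
      calc
        a / R * ‖x‖ ≤ a / R * (r * R) := by gcongr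
        _ = r * a := by field_simp
    obtain ⟨c, hc, hxc⟩ := Set.mem_iUnion₂.1 (hcov hscaled)
    refine Set.mem_iUnion₂.2 ⟨_, Finset.mem_image_of_mem _ hc, ?_⟩
    have hx_eq : x = (R / a) • (a / R) • x := by
      rw [smul_smul, div_mul_div_cancel₀ (by positivity), div_self hR.ne', one_smul]
    rw [mem_closedBall, hx_eq, dist_smul₀, Real.norm_of_nonneg (by positivity)]
    calc
      R / a * dist ((a / R) • x) c ≤ R / a * a := by gcongr; exact hxc
      _ = R := div_mul_cancel₀ R ha₀.ne'
  · have hCimage : (#(C.image ((R / a) • ·)) : ℝ) ≤ #C := by exact_mod_cast Finset.card_image_le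
    have ha : a ^ n ≤ 3 :=
      (one_div (n : ℝ) ▸ Real.one_add_inv_pow_le_exp).trans Real.exp_one_lt_three.le
    calc
      (#(C.image ((R / a) • ·)) : ℝ) ≤ 20 * n ^ 3 * (r ^ n * a ^ n) := by
        rw [← mul_pow]
        exact hCimage.trans hC
      _ ≤ 20 * n ^ 3 * (r ^ n * 3) := by gcongr
      _ = 60 * n ^ 3 * r ^ n := by ring

end BallCovering

section OrthogonalSum

theorem exists_cover_piLp {ι : Type*} [Fintype ι] {E : ι → Type*}
    [∀ j, SeminormedAddCommGroup (E j)] {S : ∀ j, Set (E j)} {C : ∀ j, Finset (E j)} {R : ι → ℝ}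
    (h : ∀ j, S j ⊆ ⋃ c ∈ C j, closedBall c (R j)) :
    ∃ D : Finset (PiLp 2 E), #D = ∏ j, #(C j) ∧
      {y : PiLp 2 E | ∀ j, y j ∈ S j} ⊆ ⋃ c ∈ D, closedBall c √(∑ j, R j ^ 2) := by
  classical
  refine ⟨(Fintype.piFinset C).map (WithLp.equiv 2 (∀ j, E j)).symm.toEmbedding, by simp,
    fun y hy => ?_⟩
  choose c hc hyc using fun j => Set.mem_iUnion₂.1 (h j (hy j))
  refine Set.mem_iUnion₂.2 ⟨WithLp.toLp 2 c,
    Finset.mem_map_of_mem _ (Fintype.mem_piFinset.2 hc), ?_⟩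
  rw [mem_closedBall, PiLp.dist_eq_of_L2]
  gcongr with j
  exact hyc j

variable {ι : Type*} [Fintype ι] {E : ι → Type*} [∀ j, NormedAddCommGroup (E j)]

/-- The set of `y` in the orthogonal sum of the spaces `E j` with `∑ j, ‖y j‖² / β j² ≤ 1`: an
ellipsoid whose semi-axes are equal to `β j` on the whole of `E j`. -/
def blockEllipsoid (E : ι → Type*) [∀ j, NormedAddCommGroup (E j)] (β : ι → ℝ) :
    Set (PiLp 2 E) :=
  {y | ∑ j, ‖y j‖ ^ 2 / β j ^ 2 ≤ 1}

variable {β : ι → ℝ}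

theorem blockEllipsoid_subset_iUnion_closedBall (hβ : ∀ j, 0 < β j) {D : ℕ} (hD : 0 < D) :
    blockEllipsoid E β ⊆ ⋃ k : ι → Fin (D + 1), ⋃ _ : ∑ j, (k j : ℕ) ≤ D,
      {y | ∀ j, y j ∈ closedBall 0 (β j * √((k j + 1) / D))} := by
  intro y hy
  set σ : ι → ℝ := fun j => ‖y j‖ ^ 2 / β j ^ 2
  have hσ₀ : ∀ j, 0 ≤ σ j := fun j => by positivity
  have hσ : ∑ j, σ j ≤ 1 := hy
  have hfloor : ∑ j, ⌊D * σ j⌋₊ ≤ D := by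
    have : (∑ j, ⌊D * σ j⌋₊ : ℝ) ≤ D :=
      calc
        (∑ j, ⌊D * σ j⌋₊ : ℝ) ≤ ∑ j, D * σ j :=
          Finset.sum_le_sum fun j _ => Nat.floor_le (mul_nonneg D.cast_nonneg (hσ₀ j))
        _ ≤ D := by
          rw [← Finset.mul_sum]
          exact mul_le_of_le_one_right D.cast_nonneg hσ
    exact_mod_cast this
  have hfloor_lt : ∀ j, ⌊D * σ j⌋₊ < D + 1 := fun j =>
    Nat.lt_succ_of_le ((Finset.single_le_sum_of_canonicallyOrdered (f := fun j => ⌊D * σ j⌋₊)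
      (Finset.mem_univ j)).trans hfloor)
  refine Set.mem_iUnion₂.2 ⟨fun j => ⟨_, hfloor_lt j⟩, hfloor, fun j => ?_⟩
  have hσ_le : σ j ≤ (⌊D * σ j⌋₊ + 1) / D := by
    rw [le_div_iff₀' (by positivity)]
    exact (Nat.lt_floor_add_one _).le
  have hy_eq : ‖y j‖ = β j * √(σ j) := by
    rw [Real.sqrt_div (sq_nonneg _), Real.sqrt_sq (norm_nonneg _), Real.sqrt_sq (hβ j).le,
      mul_div_cancel₀ _ (hβ j).ne']
  rw [mem_closedBall_zero_iff, hy_eq]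
  have := hβ j
  gcongr

variable [∀ j, InnerProductSpace ℝ (E j)] [∀ j, FiniteDimensional ℝ (E j)] [∀ j, Nontrivial (E j)]

-- The radii `√((k j + 1) / (D + #ι))` have squares summing to at most `1` because `∑ j, k j ≤ D`.
theorem exists_cover_pi_closedBall [Nonempty ι] (hβ : ∀ j, 1 ≤ β j) {D : ℕ} (hD : 0 < D)
    {k : ι → ℕ} (hk : ∑ j, k j ≤ D) :
    ∃ C : Finset (PiLp 2 E),
      {y : PiLp 2 E | ∀ j, y j ∈ closedBall 0 (β j * √((k j + 1) / D))} ⊆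
        ⋃ c ∈ C, closedBall c 1 ∧
      (#C : ℝ) ≤ ∏ j, 60 * finrank ℝ (E j) ^ 3 *
        (β j * √(1 + Fintype.card ι / D)) ^ finrank ℝ (E j) := by
  set T := Fintype.card ι
  have hT : 0 < T := Fintype.card_pos
  set R : ι → ℝ := fun j => √((k j + 1) / (D + T))
  have hR : ∀ j, 0 < R j := fun j => by positivity
  have hκ : 1 < √(1 + T / D : ℝ) := Real.lt_sqrt_of_sq_lt (by
    have : (0 : ℝ) < T / D := by positivity
    linarith)
  have hradius : ∀ j, √((k j + 1) / D : ℝ) = √(1 + T / D) * R j := fun j => by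
    rw [← Real.sqrt_mul (by positivity)]
    congr 1
    field_simp
  have hRsum : √(∑ j, R j ^ 2) ≤ 1 := by
    rw [Real.sqrt_le_one]
    calc
      ∑ j, R j ^ 2 = (∑ j, k j + T : ℕ) / (D + T) := by
        push_cast
        simp only [R, Real.sq_sqrt (by positivity : (0 : ℝ) ≤ (k _ + 1) / (D + T))]
        rw [← Finset.sum_div, Finset.sum_add_distrib, Finset.sum_const, nsmul_one,
          Finset.card_univ]
      _ ≤ 1 := div_le_one_of_le₀ (by exact_mod_cast Nat.add_le_add_right hk T) (by positivity)
  choose C hcov hC using fun j => exists_cover_closedBall_mul (E := E j)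
    (one_lt_mul_of_le_of_lt (hβ j) hκ) (hR j)
  obtain ⟨P, hP, hPcov⟩ := exists_cover_piLp hcov
  refine ⟨P, fun y hy => ?_, ?_⟩
  · simp only [hradius, ← mul_assoc] at hy
    exact Set.iUnion₂_mono (fun c _ => closedBall_subset_closedBall hRsum) (hPcov hy)
  · rw [hP, Nat.cast_prod]
    exact Finset.prod_le_prod (fun _ _ => by positivity) fun j _ => hC j

theorem exists_cover_blockEllipsoid [Nonempty ι] (hβ : ∀ j, 1 ≤ β j) {D : ℕ} (hD : 0 < D) :
    ∃ C : Finset (PiLp 2 E), blockEllipsoid E β ⊆ ⋃ c ∈ C, closedBall c 1 ∧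
      (#C : ℝ) ≤ (D + 1) ^ Fintype.card ι * ∏ j, 60 * finrank ℝ (E j) ^ 3 *
        (β j * √(1 + Fintype.card ι / D)) ^ finrank ℝ (E j) := by
  classical
  choose! C hcov hC using fun (k : ι → Fin (D + 1)) (hk : ∑ j, (k j : ℕ) ≤ D) =>
    exists_cover_pi_closedBall (E := E) hβ hD hk
  set K : Finset (ι → Fin (D + 1)) := {k | ∑ j, (k j : ℕ) ≤ D}
  refine ⟨K.biUnion C, fun y hy => ?_, ?_⟩
  · obtain ⟨k, hk, hyk⟩ := Set.mem_iUnion₂.1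
      (blockEllipsoid_subset_iUnion_closedBall (fun j => one_pos.trans_le (hβ j)) hD hy)
    obtain ⟨c, hc, hyc⟩ := Set.mem_iUnion₂.1 (hcov k hk hyk)
    exact Set.mem_iUnion₂.2 ⟨c, Finset.mem_biUnion.2 ⟨k, by simpa [K] using hk, hc⟩, hyc⟩
  · set B : ℝ := ∏ j, 60 * finrank ℝ (E j) ^ 3 *
      (β j * √(1 + Fintype.card ι / D)) ^ finrank ℝ (E j)
    have hB : 0 ≤ B := Finset.prod_nonneg fun j _ => by
      have := one_pos.trans_le (hβ j)
      positivity
    calc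
      (#(K.biUnion C) : ℝ) ≤ ∑ k ∈ K, (#(C k) : ℝ) := by exact_mod_cast Finset.card_biUnion_le
      _ ≤ #K * B := by
        rw [← nsmul_eq_mul]
        exact Finset.sum_le_card_nsmul K _ B fun k hk => hC k (by simpa [K] using hk)
      _ ≤ (D + 1) ^ Fintype.card ι * B := by
        gcongr
        exact_mod_cast (Finset.card_le_univ K).trans_eq (by simp)

theorem prod_sixty_mul_pow_le {n : ι → ℕ} (hn : 2 ≤ ∑ j, n j) (hβ : ∀ j, 0 ≤ β j) {r : ℝ}
    (hr : 0 ≤ r) :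
    ∏ j, 60 * (n j : ℝ) ^ 3 * (β j * r) ^ n j ≤
      ((∑ j, n j : ℕ) ^ 9) ^ Fintype.card ι * r ^ (∑ j, n j) * ∏ j, β j ^ n j := by
  set N := ∑ j, n j
  have hN : (60 : ℝ) ≤ N ^ 6 := by
    have : (2 : ℝ) ^ 6 ≤ N ^ 6 := by gcongr; exact_mod_cast hn
    linarith
  have hnN : ∀ j, n j ≤ N := fun j =>
    Finset.single_le_sum_of_canonicallyOrdered (Finset.mem_univ j)
  calc
    ∏ j, 60 * (n j : ℝ) ^ 3 * (β j * r) ^ n j ≤ ∏ j, N ^ 9 * (r ^ n j * β j ^ n j) :=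
      Finset.prod_le_prod (fun j _ => by have := hβ j; positivity) fun j _ => by
        have := hβ j
        calc
          60 * (n j : ℝ) ^ 3 * (β j * r) ^ n j ≤ N ^ 6 * N ^ 3 * (β j * r) ^ n j := by
            gcongr
            exact hnN j
          _ = N ^ 9 * (r ^ n j * β j ^ n j) := by ring
    _ = (N ^ 9) ^ Fintype.card ι * r ^ N * ∏ j, β j ^ n j := by
      rw [Finset.prod_mul_distrib, Finset.prod_mul_distrib, Finset.prod_const,
        Finset.prod_pow_eq_pow_sum, Finset.card_univ, mul_assoc]

-- The grid size `D = card ι * N` makes the total volume factor `√(1 + 1 / N) ^ N` bounded.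
theorem exists_cover_blockEllipsoid_of_two_le [Nonempty ι] (hβ : ∀ j, 1 ≤ β j)
    (hE : 2 ≤ ∑ j, finrank ℝ (E j)) :
    ∃ C : Finset (PiLp 2 E), blockEllipsoid E β ⊆ ⋃ c ∈ C, closedBall c 1 ∧
      (#C : ℝ) ≤ 3 * ((∑ j, finrank ℝ (E j) : ℕ) ^ 12) ^ Fintype.card ι *
        ∏ j, β j ^ finrank ℝ (E j) := by
  set N := ∑ j, finrank ℝ (E j)
  set T := Fintype.card ι
  have hT : 0 < T := Fintype.card_pos
  have hTN : T ≤ N := by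
    simpa [N, T] using Finset.card_nsmul_le_sum Finset.univ (fun j => finrank ℝ (E j)) 1
      fun j _ => finrank_pos
  have hβ₀ : ∀ j, 0 ≤ β j := fun j => zero_le_one.trans (hβ j)
  have hgrid : T * N + 1 ≤ N ^ 3 :=
    calc
      T * N + 1 ≤ N ^ 2 + N ^ 2 := by nlinarith
      _ ≤ N ^ 3 := by nlinarith
  have hratio : 1 + (T : ℝ) / (T * N : ℕ) = 1 + 1 / N := by
    push_cast
    field_simp
  have hpow : √(1 + 1 / N : ℝ) ^ N ≤ 3 :=
    calc
      √(1 + 1 / N : ℝ) ^ N ≤ (1 + 1 / N) ^ N := by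
        gcongr
        exact Real.sqrt_le_self_iff.2 (Or.inr (le_add_of_nonneg_right (by positivity)))
      _ ≤ Real.exp 1 := one_div (N : ℝ) ▸ Real.one_add_inv_pow_le_exp
      _ ≤ 3 := Real.exp_one_lt_three.le
  obtain ⟨C, hcov, hC⟩ := exists_cover_blockEllipsoid (E := E) hβ (D := T * N) (by positivity)
  rw [hratio] at hC
  refine ⟨C, hcov, hC.trans ?_⟩
  have hprod : 0 ≤ ∏ j, β j ^ finrank ℝ (E j) :=
    Finset.prod_nonneg fun j _ => pow_nonneg (hβ₀ j) _
  calc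
    _ ≤ ((T * N : ℕ) + 1 : ℝ) ^ T *
        ((N ^ 9) ^ T * √(1 + 1 / N) ^ N * ∏ j, β j ^ finrank ℝ (E j)) := by
      gcongr
      exact prod_sixty_mul_pow_le hE hβ₀ (Real.sqrt_nonneg _)
    _ ≤ ((N : ℝ) ^ 3) ^ T * ((N ^ 9) ^ T * 3 * ∏ j, β j ^ finrank ℝ (E j)) := by
      gcongr
      exact_mod_cast hgrid
    _ = 3 * (N ^ 12) ^ T * ∏ j, β j ^ finrank ℝ (E j) := by ring

end OrthogonalSum

section Fibers

variable {d : ℕ} {ι : Type*} [Fintype ι]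

/-- The decomposition of `ℝ^d` as the orthogonal sum of the coordinate subspaces indexed by the
fibres of `f`. -/
noncomputable def fiberIsometry [DecidableEq ι] (f : Fin d → ι) :
    EuclideanSpace ℝ (Fin d) ≃ₗᵢ[ℝ] PiLp 2 fun j => EuclideanSpace ℝ {i // f i = j} :=
  (LinearIsometryEquiv.piLpCongrLeft 2 ℝ ℝ (Equiv.sigmaFiberEquiv f).symm).trans
    (LinearIsometryEquiv.piLpCurry ℝ 2 fun (j : ι) (_ : {i // f i = j}) => ℝ)

@[simp]
theorem fiberIsometry_apply [DecidableEq ι] (f : Fin d → ι) (x : EuclideanSpace ℝ (Fin d))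
    (j : ι) (i : {i // f i = j}) : fiberIsometry f x j i = x i :=
  rfl

theorem fiberIsometry_mem_blockEllipsoid [DecidableEq ι] {f : Fin d → ι} {b : Fin d → ℝ}
    (hb : ∀ i, 0 < b i) {β : ι → ℝ} (hbβ : ∀ i, b i ≤ β (f i)) {x : EuclideanSpace ℝ (Fin d)}
    (hx : x ∈ ellipsoid b) :
    fiberIsometry f x ∈ blockEllipsoid (fun j => EuclideanSpace ℝ {i // f i = j}) β := by
  rw [blockEllipsoid, Set.mem_ofPred_eq]
  calc
    ∑ j, ‖fiberIsometry f x j‖ ^ 2 / β j ^ 2 =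
        ∑ j, ∑ i : {i // f i = j}, x i ^ 2 / β (f i) ^ 2 := by
      refine Finset.sum_congr rfl fun j _ => ?_
      rw [EuclideanSpace.real_norm_sq_eq, Finset.sum_div]
      exact Finset.sum_congr rfl fun i _ => by rw [fiberIsometry_apply, i.2]
    _ = ∑ i, x i ^ 2 / β (f i) ^ 2 := Fintype.sum_fiberwise f fun i => x i ^ 2 / β (f i) ^ 2
    _ ≤ ∑ i, x i ^ 2 / b i ^ 2 := Finset.sum_le_sum fun i _ => by
      have := hb i
      gcongr
      exact hbβ i
    _ ≤ 1 := hx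

theorem exists_cover_ellipsoid_of_blocks (hd : 2 ≤ d) {f : Fin d → ι} (hf : f.Surjective)
    {b : Fin d → ℝ} (hb : ∀ i, 0 < b i) {β : ι → ℝ} (hβ : ∀ j, 1 ≤ β j)
    (hbβ : ∀ i, b i ≤ β (f i)) :
    ∃ C : Finset (EuclideanSpace ℝ (Fin d)), ellipsoid b ⊆ ⋃ c ∈ C, closedBall c 1 ∧
      (#C : ℝ) ≤ 3 * (d ^ 12) ^ Fintype.card ι * ∏ i, β (f i) := by
  classical
  have hfinrank : ∀ j,
      finrank ℝ (EuclideanSpace ℝ {i // f i = j}) = Fintype.card {i // f i = j} :=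
    fun _ => finrank_euclideanSpace
  have hsum : ∑ j, finrank ℝ (EuclideanSpace ℝ {i // f i = j}) = d := by
    simp only [hfinrank, ← Fintype.card_sigma, Fintype.card_congr (Equiv.sigmaFiberEquiv f),
      Fintype.card_fin]
  have hprod : ∏ j, β j ^ finrank ℝ (EuclideanSpace ℝ {i // f i = j}) = ∏ i, β (f i) := by
    simp only [hfinrank, ← Fintype.prod_fiberwise' f β, Finset.prod_const, Finset.card_univ]
  have : Nonempty ι := ⟨f ⟨0, by lia⟩⟩
  have : ∀ j, Nontrivial (EuclideanSpace ℝ {i // f i = j}) := fun j =>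
    have : Nonempty {i // f i = j} := nonempty_subtype.2 (hf j)
    inferInstance
  obtain ⟨C, hcov, hC⟩ := exists_cover_blockEllipsoid_of_two_le
    (E := fun j => EuclideanSpace ℝ {i // f i = j}) hβ (hd.trans_eq hsum.symm)
  refine ⟨C.map (fiberIsometry f).symm.toEquiv.toEmbedding, fun x hx => ?_, ?_⟩
  · obtain ⟨c, hc, hxc⟩ := Set.mem_iUnion₂.1 (hcov (fiberIsometry_mem_blockEllipsoid hb hbβ hx))
    refine Set.mem_iUnion₂.2 ⟨(fiberIsometry f).symm c, Finset.mem_map_of_mem _ hc, ?_⟩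
    rwa [mem_closedBall, ← (fiberIsometry f).dist_map, LinearIsometryEquiv.apply_symm_apply]
  · rwa [hsum, hprod, ← Finset.card_map (fiberIsometry f).symm.toEquiv.toEmbedding] at hC

end Fibers

theorem metricEntropy_le_of_card_le_exp {d : ℕ} {ε : ℝ≥0} {S : Set (EuclideanSpace ℝ (Fin d))}
    {C : Finset (EuclideanSpace ℝ (Fin d))} (hS : S ⊆ ⋃ c ∈ C, closedBall c ε) {B : ℝ}
    (hC : (#C : ℝ) ≤ Real.exp B) : metricEntropy ε S ≤ (B : EReal) := by
  have hcov : externalCoveringNumber ε S ≤ (#C : ℕ∞) := by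
    simpa using (isCover_iff_subset_iUnion_closedBall.2 hS).externalCoveringNumber_le_encard
  have hexp : ((externalCoveringNumber ε S : ℕ∞) : ℝ≥0∞) ≤ ENNReal.ofReal (Real.exp B) :=
    calc
      ((externalCoveringNumber ε S : ℕ∞) : ℝ≥0∞) ≤ ((#C : ℕ∞) : ℝ≥0∞) := by exact_mod_cast hcov
      _ = ENNReal.ofReal (#C : ℝ) := by simp
      _ ≤ ENNReal.ofReal (Real.exp B) := ENNReal.ofReal_le_ofReal hC
  calc
    metricEntropy ε S ≤ ENNReal.log (ENNReal.ofReal (Real.exp B)) := ENNReal.log_monotone hexp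
    _ = B := by rw [ENNReal.log_ofReal_of_pos (Real.exp_pos B), Real.log_exp]

theorem card_image_natCeil_div_le {ι : Type*} [Fintype ι] {a : ι → ℝ} {L δ : ℝ} (hL : 0 ≤ L)
    (haL : ∀ i, a i ≤ L) (hδ : 0 < δ) :
    (#(Finset.univ.image fun i => ⌈a i / δ⌉₊) : ℝ) ≤ L / δ + 2 := by
  have hsub : (Finset.univ.image fun i => ⌈a i / δ⌉₊) ⊆ Finset.range (⌈L / δ⌉₊ + 1) := by
    refine Finset.image_subset_iff.2 fun i _ => Finset.mem_range_succ_iff.2 (Nat.ceil_mono ?_)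
    gcongr
    exact haL i
  calc
    (#(Finset.univ.image fun i => ⌈a i / δ⌉₊) : ℝ) ≤ ⌈L / δ⌉₊ + 1 := by
      exact_mod_cast (Finset.card_le_card hsub).trans_eq (Finset.card_range _)
    _ ≤ L / δ + 2 := by linarith [Nat.ceil_lt_add_one (div_nonneg hL hδ.le)]

theorem sum_natCeil_log_div_mul_le {d : ℕ} {b : Fin d → ℝ} (hb : ∀ i, 0 < b i) {δ : ℝ}
    (hδ : 0 < δ) :
    ∑ i, ⌈Real.log (b i) / δ⌉₊ * δ ≤ logVolumeLargeAxes b + numLargeAxes b * δ :=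
  calc
    ∑ i, ⌈Real.log (b i) / δ⌉₊ * δ ≤ ∑ i, if 1 < b i then Real.log (b i) + δ else 0 := by
      refine Finset.sum_le_sum fun i _ => ?_
      split_ifs with hi
      · calc
          ⌈Real.log (b i) / δ⌉₊ * δ ≤ (Real.log (b i) / δ + 1) * δ := by
            gcongr
            exact (Nat.ceil_lt_add_one (div_nonneg (Real.log_nonneg hi.le) hδ.le)).le
          _ = Real.log (b i) + δ := by field_simp
      · have hceil : ⌈Real.log (b i) / δ⌉₊ = 0 := Nat.ceil_eq_zero.2
          (div_nonpos_of_nonpos_of_nonneg (Real.log_nonpos (hb i).le (not_lt.1 hi)) hδ.le)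
        simp [hceil]
    _ = logVolumeLargeAxes b + numLargeAxes b * δ := by
      rw [← Finset.sum_filter, Finset.sum_add_distrib, Finset.sum_const, nsmul_eq_mul]
      rfl

theorem metricEntropy_ellipsoid_le {d : ℕ} (hd : 2 ≤ d) {b : Fin d → ℝ} (hb : ∀ i, 0 < b i)
    {L δ : ℝ} (hL : 0 ≤ L) (hbL : ∀ i, Real.log (b i) ≤ L) (hδ : 0 < δ) :
    metricEntropy 1 (ellipsoid b) ≤
      ((logVolumeLargeAxes b + numLargeAxes b * δ + (26 + 12 * (L / δ)) * Real.log d : ℝ) :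
        EReal) := by
  set g : Fin d → ℕ := fun i => ⌈Real.log (b i) / δ⌉₊
  set I := Finset.univ.image g
  obtain ⟨C, hcov, hC⟩ := exists_cover_ellipsoid_of_blocks hd
    (f := fun i => (⟨g i, Finset.mem_image_of_mem g (Finset.mem_univ i)⟩ : I))
    (fun ⟨k, hk⟩ => by simpa [I] using hk) hb
    (β := fun k => Real.exp (k * δ)) (fun k => Real.one_le_exp (by positivity)) fun i => by
      rw [← Real.log_le_iff_le_exp (hb i), ← div_le_iff₀ hδ]
      exact Nat.le_ceil _
  refine metricEntropy_le_of_card_le_exp (by exact_mod_cast hcov) (hC.trans ?_)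
  have hd' : (2 : ℝ) ≤ d := by exact_mod_cast hd
  have hthree : (3 : ℝ) ≤ Real.exp (2 * Real.log d) := by
    rw [two_mul, Real.exp_add, Real.exp_log (by positivity)]
    nlinarith
  have hblocks : ((d : ℝ) ^ 12) ^ Fintype.card I ≤ Real.exp (12 * (L / δ + 2) * Real.log d) := by
    rw [← pow_mul, ← Real.exp_log (by positivity : (0 : ℝ) < d ^ _), Real.log_pow, Real.exp_le_exp,
      Fintype.card_coe]
    push_cast
    gcongr
    exact card_image_natCeil_div_le hL hbL hδ
  have hvol : ∏ i, Real.exp (g i * δ) ≤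
      Real.exp (logVolumeLargeAxes b + numLargeAxes b * δ) := by
    rw [← Real.exp_sum, Real.exp_le_exp]
    exact sum_natCeil_log_div_mul_le hb hδ
  calc
    _ ≤ Real.exp (2 * Real.log d) * Real.exp (12 * (L / δ + 2) * Real.log d) *
        Real.exp (logVolumeLargeAxes b + numLargeAxes b * δ) := by gcongr
    _ = _ := by
      rw [← Real.exp_add, ← Real.exp_add]
      ring_nf

theorem theorem4_general {d : ℕ} (hd : 2 ≤ d) {b : Fin d → ℝ} (hb : ∀ i, 0 < b i) {B : ℝ}
    (hbB : ∀ i, b i ≤ B) :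
    metricEntropy 1 (ellipsoid b) ≤
      ((logVolumeLargeAxes b + 26 * (Real.log d +
        Real.sqrt (Real.log B * numLargeAxes b * Real.log d)) : ℝ) : EReal) := by
  have hlog : 0 < Real.log d := Real.log_pos (by exact_mod_cast hd)
  rcases Nat.eq_zero_or_pos (numLargeAxes b) with hm | hm
  · have hb_le : ∀ i, b i ≤ 1 := by
      simpa [numLargeAxes, Finset.filter_eq_empty_iff] using hm
    refine (metricEntropy_ellipsoid_le hd hb le_rfl
      (fun i => Real.log_nonpos (hb i).le (hb_le i)) one_pos).trans (EReal.coe_le_coe_iff.2 ?_)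
    simp [hm]
  · obtain ⟨i, hi⟩ := Finset.card_pos.1 hm
    have hL : 0 < Real.log B := Real.log_pos ((Finset.mem_filter.1 hi).2.trans_le (hbB i))
    set m : ℝ := (numLargeAxes b : ℝ) with hm_def
    have hm' : 0 < m := Nat.cast_pos.2 hm
    set s := √(Real.log B * m * Real.log d)
    have hs : 0 < s := by positivity
    -- `δ = s / m` balances the terms `m * δ` and `log B / δ * log d`.
    have hδ : Real.log B / (s / m) * Real.log d = s := by
      rw [div_div_eq_mul_div, div_mul_eq_mul_div, div_eq_iff hs.ne']
      exact (Real.mul_self_sqrt (by positivity)).symm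
    refine (metricEntropy_ellipsoid_le hd hb hL.le (fun i => Real.log_le_log (hb i) (hbB i))
      (div_pos hs hm')).trans (EReal.coe_le_coe_iff.2 ?_)
    rw [← hm_def, mul_div_cancel₀ s hm'.ne', add_mul, mul_assoc, hδ]
    linarith

theorem theorem4 :
    ∃ c : ℝ, 0 < c ∧
      ∀ (d : ℕ) (hd : 2 ≤ d) (b : Fin d → ℝ), Antitone b → (∀ i, 0 < b i) →
        metricEntropy 1 (ellipsoid b) ≤
          ((logVolumeLargeAxes b + c * (Real.log d +
            Real.sqrt (Real.log (b ⟨0, by omega⟩) * numLargeAxes b * Real.log d)) : ℝ) : EReal) := by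
  exact ⟨26, by norm_num, fun d hd b hanti hb =>
    theorem4_general hd hb fun i => hanti (Fin.mk_le_of_le_val (Nat.zero_le _))⟩
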